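/- An mDAG on a finite set $V$ of (visible) nodes is a pair $\mathfrak G=(\mathcal D,\mathcal B)$ of a directed acyclic graph $\mathcal D$ on $V$ and a simplicial complex $\mathcal B$ on $V$ containing all singletons; its canonical pDAG $\mathtt{can}(\mathfrak G)$ is obtained from $\mathcal D$ by adding, for every facet (inclusion-maximal face) $F$ of $\mathcal B$, a parentless latent node whose children are the elements of $F$. For pairwise disjoint $A,B,C,D\subseteq V$, the sets $A$ and $B$ are *e-separated by $C$ after deletion of $D$* in $\mathfrak G$ if $A$ and $B$ are d-separated by $C$ in (the canonical pDAG of) the sub-mDAG of $\mathfrak G$ induced on $V\setminus D$. A distribution $P$ on the values $X_V$ of finite visible variables is *realizable* by $\mathfrak G$ if, for some finite cardinalities of the latent variables and of error variables $E_a$, some functions $f_a$ and some distributions $P(E_a)$ of the error variables (one for each node $a$ of $\mathcal G=\mathtt{can}(\mathfrak G)$), $$P(X_V)=\sum_{X_{\mathrm{latent}}}\sum_{E}\prod_{a\in \mathrm{nodes}(\mathcal G)}\delta_{X_a,\,f_a(X_{\mathrm{pa}(a)},E_a)}\,P(E_a).$$ A set $S$ of events (joint values of $X_V$) is a *support realizable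 by* $\mathfrak G$ if $S=\{x : P(x)>0\}$ for some distribution $P$ realizable by $\mathfrak G$. **Lemma (the comparison of unrealizable supports subsumes the comparison of e-separation relations).** Let $\mathfrak G$ and $\mathfrak G'$ be two mDAGs with the same finite set $V$ of nodes. 1. If $\mathfrak G$ and $\mathfrak G'$ have different sets of e-separation relations, then there is a support $S$ that is realizable by one of them but not by the other; moreover $S$ can be found with all visible variables binary, i.e. $S\subseteq\{0,1\}^V$. 2. More precisely, if some e-separation relation holds in $\mathfrak G$ but not in $\mathfrak G'$, then there is $S\subseteq\{0,1\}^V$ that is a support realizable by $\mathfrak G'$ but not by $\mathfrak G$. -/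

import Mathlib

universe u v

/-- A directed acyclic graph on the node type `N`. -/
structure DAG (N : Type u) where
  edge : N → N → Prop
  acyclic : ∀ a, ¬ Relation.TransGen edge a a

namespace DAG

variable {N : Type u}

/-- The undirected graph underlying a DAG. -/
def skeleton (G : DAG N) : SimpleGraph N where
  Adj a b := G.edge a b ∨ G.edge b a
  symm := ⟨fun _ _ h => h.symm⟩
  loopless := ⟨fun a h => G.acyclic a (.single (h.elim id id))⟩

/-- The list of successive nodes `p` of a path is active given `C`: every interior node that is a
collider of the path has a descendant (possibly itself) in `C`, and no interior node that is not
a collider belongs to `C`. -/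
def IsActive (G : DAG N) (C : Set N) (p : List N) : Prop :=
  ∀ x m y, [x, m, y] <:+: p →
    ((G.edge x m ∧ G.edge y m) → ∃ c ∈ C, Relation.ReflTransGen G.edge m c) ∧
    (¬ (G.edge x m ∧ G.edge y m) → m ∉ C)

/-- `A` and `B` are d-separated by `C`: there is no path (without repeated nodes, edges traversed
in either direction) between a node of `A` and a node of `B` that is active given `C`. -/
def DSep (G : DAG N) (A B C : Set N) : Prop :=
  ∀ a ∈ A, ∀ b ∈ B, ∀ p : G.skeleton.Walk a b, p.IsPath → ¬ G.IsActive C p.support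

end DAG

/-- A partitioned DAG with visible nodes `V` and latent nodes `L`. -/
abbrev PDAG (V : Type u) (L : Type v) := DAG (V ⊕ L)

namespace PDAG

variable {V : Type u} {L : Type v}

/-- The state space of a node, when the visible variables have cardinalities `c` and the latent
variables have cardinalities `k`. -/
abbrev State (c : V → ℕ) (k : L → ℕ) : V ⊕ L → Type
  | .inl i => Fin (c i)
  | .inr l => Fin (k l)

/-- The joint assignment of values to all nodes given by an assignment `x` to the visible nodes
and an assignment `y` to the latent nodes. -/
def joint {c : V → ℕ} {k : L → ℕ} (x : ∀ i, Fin (c i)) (y : ∀ l, Fin (k l)) :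
    ∀ a : V ⊕ L, State c k a
  | .inl i => x i
  | .inr l => y l

/-- The free parameters of a classical causal model on the pDAG `G` whose visible variables have
cardinalities `c`: the cardinalities of the latent and of the error variables, for every node a
function giving its value in terms of the values of its parents and of its error variable, and a
probability distribution for every error variable. -/
structure Parameters (G : PDAG V L) (c : V → ℕ) where
  latentCard : L → ℕ
  errorCard : V ⊕ L → ℕ
  f : ∀ a, (∀ p : {p // G.edge p a}, State c latentCard p.1) → Fin (errorCard a) →
    State c latentCard a
  errorDist : ∀ a, Fin (errorCard a) → ℝ
  errorDist_mem : ∀ a, errorDist a ∈ stdSimplex ℝ (Fin (errorCard a))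

open Classical in
/-- The weight that a causal model gives to an assignment `x` of the visible variables:
`∑_{latent values} ∑_{error values} ∏_a δ(X_a, f_a(X_{pa(a)}, E_a)) P(E_a)`. -/
noncomputable def Parameters.prob [Fintype V] [Fintype L] {G : PDAG V L} {c : V → ℕ}
    (M : G.Parameters c) (x : ∀ i, Fin (c i)) : ℝ :=
  ∑ y : (∀ l, Fin (M.latentCard l)), ∑ e : (∀ a, Fin (M.errorCard a)), ∏ a : V ⊕ L,
    (if joint x y a = M.f a (fun p => joint x y p.1) (e a) then 1 else 0) * M.errorDist a (e a)

open Classical in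
/-- The set of probability distributions over visible variables of cardinalities `c` that are
realizable by the pDAG `G`, the latent variables having arbitrary finite cardinalities. -/
def realizable [Fintype V] [Fintype L] (G : PDAG V L) (c : V → ℕ) :
    Set ((∀ i, Fin (c i)) → ℝ) :=
  {P | P ∈ stdSimplex ℝ (∀ i, Fin (c i)) ∧ ∃ M : G.Parameters c, ∀ x, P x = M.prob x}

/-- The set of supports realizable by the pDAG `G`, the support of a distribution being the set of
events of positive probability. -/
def realizableSupports [Fintype V] [Fintype L] (G : PDAG V L) (c : V → ℕ) :
    Set (Set (∀ i, Fin (c i))) :=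
  {S | ∃ P ∈ G.realizable c, {x | 0 < P x} = S}

end PDAG

/-- An mDAG with nodes `V`: a DAG together with a simplicial complex over its nodes. -/
structure MDAG (V : Type u) where
  directed : DAG V
  complex : AbstractSimplicialComplex V

namespace MDAG

variable {V : Type u}

/-- The facets (inclusion-maximal faces) of the simplicial complex of an mDAG. -/
abbrev Facet (G : MDAG V) := {F : Finset V // Maximal (· ∈ G.complex.faces) F}

noncomputable instance [Fintype V] (G : MDAG V) : Fintype G.Facet := Fintype.ofFinite _

/-- The edges of the canonical pDAG: those of the directed structure, and an edge from each facet
to each of its elements. -/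
def canEdge (G : MDAG V) : V ⊕ G.Facet → V ⊕ G.Facet → Prop
  | .inl a, .inl b => G.directed.edge a b
  | .inr F, .inl b => b ∈ F.1
  | _, .inr _ => False

theorem transGen_canEdge (G : MDAG V) {a b : V ⊕ G.Facet}
    (h : Relation.TransGen G.canEdge a b) :
    ∃ j, b = .inl j ∧ ∀ i, a = .inl i → Relation.TransGen G.directed.edge i j := by
  induction h with
  | @single b h =>
    rcases b with b | b
    · refine ⟨b, rfl, ?_⟩
      rintro i rfl
      exact .single h
    · rcases a with a | a <;> exact h.elim
  | @tail b d _ h ih =>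
    obtain ⟨j, rfl, hj⟩ := ih
    rcases d with d | d
    · exact ⟨d, rfl, fun i hi => (hj i hi).tail h⟩
    · exact h.elim

/-- The canonical pDAG of an mDAG: each facet becomes a latent node without parents, whose
children are the elements of the facet. -/
def can (G : MDAG V) : PDAG V G.Facet where
  edge := G.canEdge
  acyclic a h := by
    obtain ⟨j, rfl, hj⟩ := G.transGen_canEdge h
    exact G.directed.acyclic j (hj j rfl)

/-- d-separation between sets of nodes of an mDAG, that is, in its canonical pDAG. -/
def DSep (G : MDAG V) (A B C : Set V) : Prop :=
  G.can.DSep (Sum.inl '' A) (Sum.inl '' B) (Sum.inl '' C)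

/-- The subgraph of an mDAG induced by a set of nodes. -/
def induce (G : MDAG V) (S : Set V) : MDAG S where
  directed :=
    { edge := fun a b => G.directed.edge a b
      acyclic := fun a h => G.directed.acyclic a (h.lift Subtype.val fun _ _ h => h) }
  complex :=
    { faces := {F | F.map (Function.Embedding.subtype _) ∈ G.complex.faces}
      isRelLowerSet_faces := by
        intro F hF
        have h := G.complex.isRelLowerSet_faces hF
        refine ⟨Finset.map_nonempty.1 h.1, fun F' hle hne => ?_⟩
        exact h.2 (Finset.map_subset_map.2 hle) (Finset.map_nonempty.2 hne)
      singleton_mem := by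
        intro a
        simpa using G.complex.singleton_mem a.1 }

/-- `A` and `B` are e-separated by `C` after deletion of `D`. -/
def ESep (G : MDAG V) (A B C D : Set V) : Prop :=
  (G.induce Dᶜ).DSep (Subtype.val ⁻¹' A) (Subtype.val ⁻¹' B) (Subtype.val ⁻¹' C)

/-- The set of e-separation relations of an mDAG: all quadruples `(A, B, C, D)` of pairwise
disjoint sets of nodes such that `A` and `B` are e-separated by `C` after deletion of `D`. -/
def eSepRelations (G : MDAG V) : Set (Set V × Set V × Set V × Set V) :=
  {r | [r.1, r.2.1, r.2.2.1, r.2.2.2].Pairwise Disjoint ∧ G.ESep r.1 r.2.1 r.2.2.1 r.2.2.2}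

/-- The set of supports, over visible variables of cardinalities `c`, realizable by an mDAG, that
is, by its canonical pDAG. -/
def realizableSupports [Fintype V] (G : MDAG V) (c : V → ℕ) : Set (Set (∀ i, Fin (c i))) :=
  PDAG.realizableSupports G.can c

end MDAG

/-! Part 1 follows from part 2: if the two sets of relations differ, one of them is not contained in
the other. For part 2, let `A` and `B` be e-separated by `C` after deletion of `D` in `G` but not in
`G'`. The support `T` that tells them apart is a set of binary events where `D` is constantly `0`,
where `C = 0` forces `x a = x b` for some `a ∈ A` and `b ∈ B`, and where both common values occur
with `C = 0`.

`G` cannot realize `T` (`ESep.exists_mem_support`). The possible error values form a product, so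
those of two events can be mixed node by node. By d-separation (`DSep.exists_partition`) the nodes
outside `C` split into two sides so that the family of every relevant ancestor lies, up to `C`, on
one side. Taking each error from the event of its side gives a solution that follows one event on
`A` and the other on `B`. The two events agree on `C`, and they agree with the mixed one on `D`
because it also lies in `T`. Mixing an event with `x a = x b = 0` and one with `x a = x b = 1`
contradicts the definition of `T`.

`G'` realizes `T` (`exists_binary_equations`). Along an active path bits are copied, each collider
compares its two neighbours, and a directed path reports a difference to `C`. The path must not
repeat nodes and the reports must avoid it. Both come from minimizing, over active routes with
possible repetitions, the number of edges plus the lengths of the descents from the colliders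
(`exists_route_of_not_dsep`). Counting the descents matters because cutting out a loop can create a
new collider. -/

/-! ### Active routes of minimal cost and d-separation -/

namespace DAG

variable {N : Type u}

theorem not_edge_symm (G : DAG N) {a b : N} (h : G.edge a b) : ¬ G.edge b a :=
  fun h' => G.acyclic a ((Relation.TransGen.single h).tail h')

/-- `FreePath G C u k w`: there is a directed path with `k` edges from `u` to `w` none of whose
nodes, except possibly `w`, belongs to `C`. -/
inductive FreePath (G : DAG N) (C : Set N) : N → ℕ → N → Prop
  | refl (u : N) : FreePath G C u 0 u
  | step {u v w : N} {k : ℕ} : u ∉ C → G.edge u v → FreePath G C v k w →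
      FreePath G C u (k + 1) w

/-- There is a directed path with `d` edges from `v` to `C`, which meets `C` only at its end. -/
def Descent (G : DAG N) (C : Set N) (d : ℕ) (v : N) : Prop :=
  ∃ c ∈ C, G.FreePath C v d c

/-- `ActiveRoute G C b v s l n`: the list `l` is an active route given `C` from `v` to `b`. The
route enters `v` through an arrow pointing to `v` if `s` is `true`, and through an arrow leaving
`v` if `s` is `false`. The cost `n` is the number of edges of the route plus, for every collider,
the length of a directed path from the collider to `C`. -/
inductive ActiveRoute (G : DAG N) (C : Set N) (b : N) : N → Bool → List N → ℕ → Prop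
  | nil (s : Bool) : ActiveRoute G C b b s [b] 0
  | down {v w : N} {s : Bool} {l : List N} {n : ℕ} : v ∉ C → G.edge v w →
      ActiveRoute G C b w true l n → ActiveRoute G C b v s (v :: l) (n + 1)
  | up {v w : N} {l : List N} {n : ℕ} : v ∉ C → G.edge w v →
      ActiveRoute G C b w false l n → ActiveRoute G C b v false (v :: l) (n + 1)
  | collide {v w : N} {l : List N} {n d : ℕ} : G.Descent C d v → G.edge w v →
      ActiveRoute G C b w false l n → ActiveRoute G C b v true (v :: l) (n + 1 + d)

/-- The cost `n` is minimal among the active routes from `v` to `b` with the same state at `v`. -/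
def MinCost (G : DAG N) (C : Set N) (b v : N) (s : Bool) (n : ℕ) : Prop :=
  ∀ l n', G.ActiveRoute C b v s l n' → n ≤ n'

variable {G : DAG N} {C : Set N}

theorem FreePath.reach {u w : N} {k : ℕ} (h : G.FreePath C u k w) :
    Relation.ReflTransGen G.edge u w := by
  induction h with
  | refl => exact .refl
  | step _ h _ ih => exact .head h ih

theorem FreePath.tail {u w z : N} {k : ℕ} (h : G.FreePath C u k w) (hw : w ∉ C)
    (hz : G.edge w z) : G.FreePath C u (k + 1) z := by
  induction h with
  | refl => exact .step hw hz (.refl _)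
  | step h1 h2 _ ih => exact .step h1 h2 (ih hw hz)

theorem Descent.step {u v : N} {d : ℕ} (hu : u ∉ C) (h : G.edge u v) (hd : G.Descent C d v) :
    G.Descent C (d + 1) u :=
  let ⟨c, hc, hp⟩ := hd
  ⟨c, hc, .step hu h hp⟩

theorem Descent.of_reach {u c : N} (h : Relation.ReflTransGen G.edge u c) (hc : c ∈ C) :
    ∃ d, G.Descent C d u := by
  induction h using Relation.ReflTransGen.head_induction_on with
  | refl => exact ⟨0, c, hc, .refl c⟩
  | @head u v h _ ih =>
    by_cases hu : u ∈ C
    · exact ⟨0, u, hu, .refl u⟩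
    · obtain ⟨d, hd⟩ := ih
      exact ⟨d + 1, hd.step hu h⟩

namespace ActiveRoute

variable {b v : N} {s : Bool} {l : List N} {n : ℕ}

theorem exists_cons (h : G.ActiveRoute C b v s l n) : ∃ t, l = v :: t := by
  cases h <;> exact ⟨_, rfl⟩

/-- Changing the arrow of entry at `v` can only turn a collider into a chain, which saves its
descent. -/
theorem toOut (h : G.ActiveRoute C b v true l n) (hv : v ∉ C) :
    ∃ n' ≤ n, G.ActiveRoute C b v false l n' := by
  cases h with
  | nil => exact ⟨0, le_rfl, .nil _⟩
  | down h1 h2 h3 => exact ⟨_, le_rfl, .down h1 h2 h3⟩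
  | collide hd h2 h3 => exact ⟨_, Nat.le_add_right _ _, .up hv h2 h3⟩

/-- The cost grows by at most `d`, namely when `v` becomes a collider. -/
theorem toIn (h : G.ActiveRoute C b v s l n) {d : ℕ} (hd : G.Descent C d v) :
    ∃ n' ≤ n + d, G.ActiveRoute C b v true l n' := by
  cases h with
  | nil => exact ⟨0, by omega, .nil _⟩
  | down h1 h2 h3 => exact ⟨_, by omega, .down h1 h2 h3⟩
  | up h1 h2 h3 => exact ⟨_, le_rfl, .collide hd h2 h3⟩
  | collide hd' h2 h3 => exact ⟨_, by omega, .collide hd' h2 h3⟩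

theorem exists_suffix (h : G.ActiveRoute C b v s l n) {u : N} (hu : u ∈ l) :
    ∃ s' l' n', G.ActiveRoute C b u s' l' n' ∧ n' ≤ n := by
  induction h with
  | nil s =>
    obtain rfl := List.mem_singleton.1 hu
    exact ⟨s, _, _, .nil s, le_rfl⟩
  | down h1 h2 h3 ih =>
    rcases List.mem_cons.1 hu with rfl | hu
    · exact ⟨_, _, _, .down (s := true) h1 h2 h3, le_rfl⟩
    · obtain ⟨s', l', n', h, hn⟩ := ih hu
      exact ⟨s', l', n', h, by omega⟩
  | up h1 h2 h3 ih =>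
    rcases List.mem_cons.1 hu with rfl | hu
    · exact ⟨_, _, _, .up h1 h2 h3, le_rfl⟩
    · obtain ⟨s', l', n', h, hn⟩ := ih hu
      exact ⟨s', l', n', h, by omega⟩
  | collide h1 h2 h3 ih =>
    rcases List.mem_cons.1 hu with rfl | hu
    · exact ⟨_, _, _, .collide h1 h2 h3, le_rfl⟩
    · obtain ⟨s', l', n', h, hn⟩ := ih hu
      exact ⟨s', l', n', h, by omega⟩

/-- A node of a route that starts downwards is a descendant of the first node, unless the route
meets a collider before. -/
theorem reach_or_descent (h : G.ActiveRoute C b v s l n) (hs : s = true) {u : N} (hu : u ∈ l) :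
    Relation.ReflTransGen G.edge v u ∨
      ∃ d s' l' n', G.Descent C d v ∧ G.ActiveRoute C b u s' l' n' ∧ n' + d + 1 ≤ n := by
  induction h with
  | nil s =>
    obtain rfl := List.mem_singleton.1 hu
    exact .inl .refl
  | down h1 h2 h3 ih =>
    rcases List.mem_cons.1 hu with rfl | hu
    · exact .inl .refl
    · rcases ih rfl hu with h | ⟨d, s', l', n', hd, h, hn⟩
      · exact .inl (.head h2 h)
      · exact .inr ⟨d + 1, s', l', n', hd.step h1 h2, h, by omega⟩
  | up => cases hs
  | collide h1 h2 h3 ih =>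
    rcases List.mem_cons.1 hu with rfl | hu
    · exact .inl .refl
    · obtain ⟨s', l', n', h, hn⟩ := h3.exists_suffix hu
      exact .inr ⟨_, s', l', n', h1, h, by omega⟩

theorem minCost_down {w : N} (h1 : v ∉ C) (h2 : G.edge v w) (h : G.MinCost C b v s (n + 1)) :
    G.MinCost C b w true n :=
  fun _ _ h' => Nat.le_of_succ_le_succ (h _ _ (.down h1 h2 h'))

theorem minCost_up {w : N} (h1 : v ∉ C) (h2 : G.edge w v) (h : G.MinCost C b v false (n + 1)) :
    G.MinCost C b w false n :=
  fun _ _ h' => Nat.le_of_succ_le_succ (h _ _ (.up h1 h2 h'))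

theorem minCost_collide {w : N} {d : ℕ} (h1 : G.Descent C d v) (h2 : G.edge w v)
    (h : G.MinCost C b v true (n + 1 + d)) : G.MinCost C b w false n := fun _ _ h' => by
  have := h _ _ (.collide h1 h2 h')
  omega

/-- A route of minimal cost has no repeated nodes. -/
theorem nodup (h : G.ActiveRoute C b v s l n) (hmin : G.MinCost C b v s n) : l.Nodup := by
  induction h with
  | nil => simp
  | @down v w s l n h1 h2 h3 ih =>
    refine List.nodup_cons.2 ⟨fun hv => ?_, ih (minCost_down h1 h2 hmin)⟩
    -- A return to `v` either closes a directed cycle or comes after a collider. In the latter case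
    -- the descent of that collider, already paid for, serves `v` in the shortened route.
    rcases h3.reach_or_descent rfl hv with h | ⟨d, s', l', n', hd, h, hn⟩
    · exact G.acyclic v (.head' h2 h)
    · have : ∃ n'' < n + 1, G.ActiveRoute C b v s l' n'' := by
        rcases s <;> rcases s'
        · exact ⟨n', by omega, h⟩
        · obtain ⟨n'', hle, h'⟩ := h.toOut h1
          exact ⟨n'', by omega, h'⟩
        · obtain ⟨n'', hle, h'⟩ := h.toIn (hd.step h1 h2)
          exact ⟨n'', by omega, h'⟩
        · exact ⟨n', by omega, h⟩
      obtain ⟨n'', hlt, h'⟩ := this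
      exact absurd (hmin _ _ h') (by omega)
  | @up v w l n h1 h2 h3 ih =>
    refine List.nodup_cons.2 ⟨fun hv => ?_, ih (minCost_up h1 h2 hmin)⟩
    obtain ⟨s', l', n', h, hn⟩ := h3.exists_suffix hv
    have : ∃ n'' ≤ n', G.ActiveRoute C b v false l' n'' := by
      rcases s'
      · exact ⟨n', le_rfl, h⟩
      · exact h.toOut h1
    obtain ⟨n'', hlt, h'⟩ := this
    exact absurd (hmin _ _ h') (by omega)
  | @collide v w l n d h1 h2 h3 ih =>
    refine List.nodup_cons.2 ⟨fun hv => ?_, ih (minCost_collide h1 h2 hmin)⟩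
    obtain ⟨s', l', n', h, hn⟩ := h3.exists_suffix hv
    obtain ⟨n'', hle, h'⟩ := h.toIn h1
    exact absurd (hmin _ _ h') (by omega)

theorem prepend {u : N} {k : ℕ} (hp : G.FreePath C u k v) (h : G.ActiveRoute C b v true l n) :
    ∃ l', G.ActiveRoute C b u true l' (n + k) := by
  induction hp with
  | refl => exact ⟨l, h⟩
  | step h1 h2 _ ih =>
    obtain ⟨l', h'⟩ := ih h
    exact ⟨_, .down h1 h2 h'⟩

/-- On a route of minimal cost, a shortest directed path from a collider to `C` does not meet the
part of the route after the collider. -/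
theorem descent_avoids (h : G.ActiveRoute C b v s l n) (hmin : G.MinCost C b v s n)
    {p q : List N} {x m y : N} (hl : l = p ++ x :: m :: y :: q) (hx : G.edge x m)
    (hy : G.edge y m) {d : ℕ} (hd : ∀ d', G.Descent C d' m → d ≤ d') {u : N} {k d' : ℕ}
    (hu : G.FreePath C m k u) (hu' : G.Descent C d' u) (hk : k + d' = d) : u ∉ y :: q := by
  induction h generalizing p with
  | nil =>
    have := congrArg List.length hl
    simp only [List.length_append, List.length_cons, List.length_nil] at this
    omega
  | @down v w s l n h1 h2 h3 ih =>
    rcases p with _ | ⟨z, p⟩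
    · obtain ⟨rfl, rfl⟩ := List.cons.inj hl
      have hmin' := minCost_down h1 h2 hmin
      cases h3 with
      | down h4 h5 h6 =>
        obtain ⟨t, ht⟩ := h6.exists_cons
        cases ht
        exact absurd hy (G.not_edge_symm h5)
      | @collide _ _ _ n d₀ h4 h5 h6 =>
        intro hmem
        -- If the descent met the later route at `u`, one could follow it from `m` to `u` and
        -- continue from there, with the remaining descent in case `u` becomes a collider. The cost
        -- is at most `n + k + d' = n + d`, below `n + 1 + d₀`.
        obtain ⟨s', l', n', h, hn⟩ := h6.exists_suffix hmem
        obtain ⟨n'', hle, h'⟩ := h.toIn hu'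
        obtain ⟨l'', h''⟩ := h'.prepend hu
        have := hmin' _ _ h''
        have := hd _ h4
        omega
    · exact ih (minCost_down h1 h2 hmin) (List.cons.inj hl).2
  | @up v w l n h1 h2 h3 ih =>
    rcases p with _ | ⟨z, p⟩
    · obtain ⟨rfl, rfl⟩ := List.cons.inj hl
      obtain ⟨t, ht⟩ := h3.exists_cons
      cases ht
      exact absurd hx (G.not_edge_symm h2)
    · exact ih (minCost_up h1 h2 hmin) (List.cons.inj hl).2
  | @collide v w l n d h1 h2 h3 ih =>
    rcases p with _ | ⟨z, p⟩
    · obtain ⟨rfl, rfl⟩ := List.cons.inj hl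
      obtain ⟨t, ht⟩ := h3.exists_cons
      cases ht
      exact absurd hx (G.not_edge_symm h2)
    · exact ih (minCost_collide h1 h2 hmin) (List.cons.inj hl).2

/-- Reversal with an accumulator: `r` is the part already reversed. An edge that points to `v`
leaves `x`, whence the state `!s`. Colliders remain colliders, so the cost is preserved. -/
theorem reverse_append {a : N} (hb : b ∉ C) (h : G.ActiveRoute C b v s l n) {r : List N} {m : ℕ}
    {x : N} (hr : G.ActiveRoute C a x (!s) r m)
    (hx : if s then G.edge x v else G.edge v x) :
    G.ActiveRoute C a b false (l.reverse ++ r) (n + m + 1) := by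
  induction h generalizing r m x with
  | nil s =>
    cases s
    · simpa using hr.down hb hx
    · simpa using hr.up hb hx
  | @down v w s l n h1 h2 h3 ih =>
    have : G.ActiveRoute C a v false (v :: r) (m + 1) := by
      cases s
      · exact hr.down h1 hx
      · exact hr.up h1 hx
    have := ih this h2
    rw [List.reverse_cons, List.append_assoc]
    exact (by omega : n + (m + 1) + 1 = n + 1 + m + 1) ▸ this
  | @up v w l n h1 h2 h3 ih =>
    have := ih (hr.down h1 hx) h2
    rw [List.reverse_cons, List.append_assoc]
    exact (by omega : n + (m + 1) + 1 = n + 1 + m + 1) ▸ this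
  | @collide v w l n d h1 h2 h3 ih =>
    have := ih (hr.collide h1 hx) h2
    rw [List.reverse_cons, List.append_assoc]
    exact (by omega : n + (m + 1 + d) + 1 = n + 1 + d + m + 1) ▸ this

theorem reverse {a : N} (hb : b ∉ C) (h : G.ActiveRoute C b a false l n) :
    G.ActiveRoute C a b false l.reverse n := by
  cases h with
  | nil => exact .nil _
  | down h1 h2 h3 =>
    rw [List.reverse_cons]
    simpa using reverse_append hb h3 (.nil false) h2
  | up h1 h2 h3 =>
    rw [List.reverse_cons]
    simpa using reverse_append hb h3 (.nil true) h2

theorem isActive_cons (h : G.ActiveRoute C b v s l n) {z : N}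
    (hz : if s then G.edge z v else G.edge v z) : G.IsActive C (z :: l) := by
  induction h generalizing z with
  | nil s =>
    intro x m y hi
    have := hi.length_le
    simp at this
  | @down v w s l n h1 h2 h3 ih =>
    obtain ⟨t, rfl⟩ := h3.exists_cons
    intro x m y hi
    rcases List.infix_cons_iff.1 hi with hi | hi
    · simp only [List.cons_prefix_cons] at hi
      obtain ⟨rfl, rfl, rfl, -⟩ := hi
      exact ⟨fun h => absurd h.2 (G.not_edge_symm h2), fun _ => h1⟩
    · exact ih (z := v) h2 x m y hi
  | @up v w l n h1 h2 h3 ih =>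
    obtain ⟨t, rfl⟩ := h3.exists_cons
    intro x m y hi
    rcases List.infix_cons_iff.1 hi with hi | hi
    · simp only [List.cons_prefix_cons] at hi
      obtain ⟨rfl, rfl, rfl, -⟩ := hi
      exact ⟨fun h => absurd h.1 (G.not_edge_symm hz), fun _ => h1⟩
    · exact ih (z := v) h2 x m y hi
  | @collide v w l n d h1 h2 h3 ih =>
    obtain ⟨t, rfl⟩ := h3.exists_cons
    intro x m y hi
    rcases List.infix_cons_iff.1 hi with hi | hi
    · simp only [List.cons_prefix_cons] at hi
      obtain ⟨rfl, rfl, rfl, -⟩ := hi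
      obtain ⟨c, hc, hp⟩ := h1
      exact ⟨fun _ => ⟨c, hc, hp.reach⟩, fun h => absurd ⟨hz, h2⟩ h⟩
    · exact ih (z := v) h2 x m y hi

theorem isActive (h : G.ActiveRoute C b v false l n) : G.IsActive C l := by
  cases h with
  | nil =>
    intro x m y hi
    have := hi.length_le
    simp at this
  | down h1 h2 h3 => exact h3.isActive_cons h2
  | up h1 h2 h3 => exact h3.isActive_cons h2

theorem exists_walk (h : G.ActiveRoute C b v s l n) :
    ∃ p : G.skeleton.Walk v b, p.support = l := by
  induction h with
  | nil => exact ⟨.nil, rfl⟩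
  | down _ h2 _ ih =>
    obtain ⟨p, rfl⟩ := ih
    exact ⟨.cons (.inl h2) p, rfl⟩
  | up _ h2 _ ih =>
    obtain ⟨p, rfl⟩ := ih
    exact ⟨.cons (.inr h2) p, rfl⟩
  | collide _ h2 _ ih =>
    obtain ⟨p, rfl⟩ := ih
    exact ⟨.cons (.inr h2) p, rfl⟩

theorem of_walk_cons {x : N} (p : G.skeleton.Walk v b) (h : G.IsActive C (x :: p.support))
    (hx : if s then G.edge x v else G.edge v x) :
    ∃ n, G.ActiveRoute C b v s p.support n := by
  induction p generalizing x s with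
  | nil => exact ⟨0, .nil s⟩
  | @cons v w b hvw p ih =>
    have htail : G.IsActive C (v :: p.support) := fun x' m y hi =>
      h x' m y (hi.trans (List.suffix_cons _ _).isInfix)
    obtain ⟨t, ht⟩ : ∃ t, p.support = w :: t := by cases p <;> exact ⟨_, rfl⟩
    have htriple := h x v w (by
      rw [SimpleGraph.Walk.support_cons, ht]
      exact ⟨[], t, rfl⟩)
    rcases hvw with hvw | hvw
    · obtain ⟨n, hn⟩ := ih (s := true) htail hvw
      exact ⟨_, .down (htriple.2 fun h => G.not_edge_symm hvw h.2) hvw hn⟩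
    · obtain ⟨n, hn⟩ := ih (s := false) htail hvw
      cases s
      · exact ⟨_, .up (htriple.2 fun h => G.not_edge_symm hx h.1) hvw hn⟩
      · obtain ⟨c, hc, hr⟩ := htriple.1 ⟨hx, hvw⟩
        obtain ⟨d, hd⟩ := Descent.of_reach hr hc
        exact ⟨_, .collide hd hvw hn⟩

theorem of_walk {a : N} (ha : a ∉ C) (p : G.skeleton.Walk a b) (h : G.IsActive C p.support) :
    ∃ n, G.ActiveRoute C b a false p.support n := by
  cases p with
  | nil => exact ⟨0, .nil false⟩
  | cons hvw p =>
    rcases hvw with hvw | hvw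
    · obtain ⟨n, hn⟩ := of_walk_cons (s := true) p h hvw
      exact ⟨_, .down ha hvw hn⟩
    · obtain ⟨n, hn⟩ := of_walk_cons (s := false) p h hvw
      exact ⟨_, .up ha hvw hn⟩

theorem exists_minCost {a : N} (h : ∃ l n, G.ActiveRoute C b a s l n) :
    ∃ l n, G.ActiveRoute C b a s l n ∧ G.MinCost C b a s n := by
  classical
  have h' : ∃ n l, G.ActiveRoute C b a s l n := exists_comm.1 h
  obtain ⟨l, hl⟩ := Nat.find_spec h'
  exact ⟨l, _, hl, fun l' n' h => Nat.find_min' h' ⟨l', h⟩⟩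

end ActiveRoute

/-- d-separation only excludes paths, but a route of minimal cost is a path. -/
theorem DSep.not_activeRoute {A B : Set N} (h : G.DSep A B C) {a b : N} (ha : a ∈ A)
    (hb : b ∈ B) {l : List N} {n : ℕ} : ¬ G.ActiveRoute C b a false l n := by
  intro hr
  obtain ⟨l, n, hr, hmin⟩ := ActiveRoute.exists_minCost ⟨l, n, hr⟩
  obtain ⟨p, rfl⟩ := hr.exists_walk
  exact h a ha b hb p (.mk' (hr.nodup hmin)) hr.isActive

/-- If `A` and `B` are d-separated by `C`, the nodes outside `C` can be divided into two parts, one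
containing `A` and the other one containing `B`, so that no family of an ancestor of `A ∪ B ∪ C`
meets both. -/
theorem DSep.exists_partition {A B : Set N} (h : G.DSep A B C) :
    ∃ W : Set N, B ⊆ W ∧ Disjoint A W ∧
      ∀ z, (∃ t ∈ A ∪ B ∪ C, Relation.ReflTransGen G.edge z t) →
        ∀ p q, (p = z ∨ G.edge p z) → (q = z ∨ G.edge q z) → p ∉ C → q ∉ C → p ∈ W → q ∈ W := by
  set W : Set N := {v | ∃ b ∈ B, ∃ l n, G.ActiveRoute C b v false l n} with hW
  have hAW : Disjoint A W := Set.disjoint_left.2 fun a ha ⟨b, hb, l, n, hr⟩ =>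
    h.not_activeRoute ha hb hr
  have up : ∀ p z, G.edge p z → z ∉ C → p ∈ W → z ∈ W := by
    rintro p z hpz hz ⟨b, hb, l, n, hr⟩
    exact ⟨b, hb, _, _, .up hz hpz hr⟩
  have down : ∀ p z, (∃ t ∈ A ∪ B ∪ C, Relation.ReflTransGen G.edge z t) →
      G.edge p z → p ∉ C → z ∉ C → z ∈ W → p ∈ W := by
    rintro p z ⟨t, ht, hzt⟩ hpz hp hz ⟨b, hb, l, n, hr⟩
    -- Entering `z` from `p` may make it a collider, which is harmless if `z` has a descendant in
    -- `C`. Otherwise no directed path from `z` meets `C`: one to `A` would put a node of `A` in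
    -- `W`, and one to `B` is itself an active route.
    by_cases hzC : ∃ c ∈ C, Relation.ReflTransGen G.edge z c
    · obtain ⟨c, hc, hzc⟩ := hzC
      obtain ⟨d, hd⟩ := Descent.of_reach hzc hc
      obtain ⟨n', -, hr'⟩ := hr.toIn hd
      exact ⟨b, hb, _, _, .down hp hpz hr'⟩
    · rcases ht with (ht | ht) | ht
      · exfalso
        have key : t ∈ W := by
          clear hpz
          have hz' : z ∈ W := ⟨b, hb, l, n, hr⟩
          clear hr
          induction hzt with
          | refl => exact hz'
          | @tail u w hu huw ih =>
            clear ih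
            have : ∀ u, Relation.ReflTransGen G.edge z u → u ∈ W := by
              intro u hu
              induction hu with
              | refl => exact hz'
              | tail hu' huw ih => exact up _ _ huw (fun hc => hzC ⟨_, hc, hu'.tail huw⟩) ih
            exact this w (hu.tail huw)
        exact Set.disjoint_left.1 hAW ht key
      · have : ∃ l n, G.ActiveRoute C t z true l n := by
          clear hpz hr hz
          induction hzt using Relation.ReflTransGen.head_induction_on with
          | refl => exact ⟨_, _, .nil true⟩
          | @head u w huw _ ih =>
            obtain ⟨l, n, hr⟩ := ih fun ⟨c, hc, hwc⟩ => hzC ⟨c, hc, .head huw hwc⟩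
            exact ⟨_, _, .down (fun hu => hzC ⟨u, hu, .refl⟩) huw hr⟩
        obtain ⟨l, n, hr⟩ := this
        exact ⟨t, ht, _, _, .down hp hpz hr⟩
      · exact absurd ⟨t, ht, hzt⟩ hzC
  refine ⟨W, fun b hb => ⟨b, hb, _, _, .nil false⟩, hAW, ?_⟩
  rintro z hz p q (rfl | hp) (rfl | hq) hpC hqC hpW
  · exact hpW
  · exact down _ _ hz hq hqC hpC hpW
  · exact up _ _ hp hqC hpW
  · by_cases hzC : ∃ c ∈ C, Relation.ReflTransGen G.edge z c
    · obtain ⟨c, hc, hzc⟩ := hzC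
      obtain ⟨d, hd⟩ := Descent.of_reach hzc hc
      obtain ⟨b, hb, l, n, hr⟩ := hpW
      exact ⟨b, hb, _, _, .down hqC hq (.collide hd hp hr)⟩
    · have hzC' : z ∉ C := fun hc => hzC ⟨z, hc, .refl⟩
      exact down _ _ hz hq hqC hzC' (up _ _ hp hzC' hpW)

/-- If `A` and `B` are not d-separated by `C`, they are joined by an active path such that every
collider has a directed path to `C` that avoids the rest of the path. -/
theorem exists_route_of_not_dsep {A B : Set N} (h : ¬ G.DSep A B C) (hAC : Disjoint A C)
    (hBC : Disjoint B C) :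
    ∃ a ∈ A, ∃ b ∈ B, ∃ p : G.skeleton.Walk a b, p.IsPath ∧ G.IsActive C p.support ∧
      ∀ x m y, [x, m, y] <:+: p.support → G.edge x m → G.edge y m →
        ∃ c ∈ C, Relation.ReflTransGen (fun u w => G.edge u w ∧ w ∉ p.support) m c := by
  classical
  simp only [DSep, not_forall, not_not] at h
  obtain ⟨a, ha, b, hb, p₀, -, hp₀⟩ := h
  have haC := Set.disjoint_left.1 hAC ha
  have hbC := Set.disjoint_left.1 hBC hb
  obtain ⟨n₀, hr₀⟩ := ActiveRoute.of_walk haC p₀ hp₀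
  obtain ⟨l, n, hr, hmin⟩ := ActiveRoute.exists_minCost ⟨_, n₀, hr₀⟩
  obtain ⟨p, rfl⟩ := hr.exists_walk
  have hr' := hr.reverse hbC
  have hmin' : G.MinCost C a b false n := fun l' n' h => hmin _ _ (h.reverse haC)
  refine ⟨a, ha, b, hb, p, .mk' (hr.nodup hmin), hr.isActive, ?_⟩
  rintro x m y ⟨q₁, q₂, hl⟩ hx hy
  obtain ⟨c₀, hc₀, hmc₀⟩ := (hr.isActive x m y ⟨q₁, q₂, hl⟩).1 ⟨hx, hy⟩
  have hex := Descent.of_reach hmc₀ hc₀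
  have hdmin : ∀ d', G.Descent C d' m → Nat.find hex ≤ d' := fun d' h => Nat.find_min' hex h
  obtain ⟨c, hc, hmc⟩ := Nat.find_spec hex
  have hl' : p.support = q₁ ++ x :: m :: y :: q₂ := by simpa using hl.symm
  have hlr : p.support.reverse = q₂.reverse ++ y :: m :: x :: q₁.reverse := by simp [hl']
  -- `descent_avoids` concerns the part after the collider; applied to the reversed route it covers
  -- the part before. The collider itself is excluded by `k + 1 > 0` and the minimality of the
  -- descent.
  have avoid : ∀ u k d', G.FreePath C m (k + 1) u → G.Descent C d' u →
      k + 1 + d' = Nat.find hex → u ∉ p.support := by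
    intro u k d' hu hu' hk hmem
    have h1 := hr.descent_avoids hmin hl' hx hy hdmin hu hu' hk
    have h2 := hr'.descent_avoids hmin' hlr hy hx hdmin hu hu' hk
    rw [hl'] at hmem
    simp only [List.mem_append, List.mem_cons, List.mem_reverse] at hmem h1 h2
    have hum : u = m := by tauto
    subst hum
    have := hdmin _ hu'
    omega
  refine ⟨c, hc, ?_⟩
  have key : ∀ u j w, G.FreePath C u j w → w = c → ∀ k, G.FreePath C m k u →
      k + j = Nat.find hex →
      Relation.ReflTransGen (fun u w => G.edge u w ∧ w ∉ p.support) u c := by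
    intro u j w h
    induction h with
    | refl => rintro rfl k - -; exact .refl
    | @step u v w j h1 h2 h3 ih =>
      rintro rfl k hk hj
      have hk' := hk.tail h1 h2
      exact .head ⟨h2, avoid v k j hk' ⟨_, hc, h3⟩ (by omega)⟩
        (ih rfl (k + 1) hk' (by omega))
  exact key m _ c hmc rfl 0 (.refl m) (by omega)

end DAG

/-! ### Structural equations and possibilistic realizability -/

namespace DAG

variable {N : Type u}

theorem wellFounded_edge [Finite N] (G : DAG N) : WellFounded G.edge :=
  haveI : Std.Irrefl (Relation.TransGen G.edge) := ⟨G.acyclic⟩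
  Subrelation.wf (fun h => Relation.TransGen.single h)
    (Finite.wellFounded_of_trans_of_irrefl (Relation.TransGen G.edge))

/-- Structural equations over a finite DAG have exactly one solution. -/
theorem existsUnique_solution [Finite N] (G : DAG N) {σ : N → Type v}
    (F : ∀ a, (∀ p : {p // G.edge p a}, σ p.1) → σ a) :
    ∃! z : ∀ a, σ a, ∀ a, z a = F a fun p => z p.1 := by
  refine ⟨G.wellFounded_edge.fix fun a ih => F a fun p => ih p.1 p.2, fun a => ?_, ?_⟩
  · exact G.wellFounded_edge.fix_eq _ a
  · intro z hz
    funext a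
    induction a using G.wellFounded_edge.induction with
    | _ a ih =>
      rw [hz a, G.wellFounded_edge.fix_eq]
      congr 1
      funext p
      exact ih p.1 p.2

end DAG

namespace PDAG

variable {V : Type u} {L : Type v} {G : PDAG V L} {c : V → ℕ}

theorem joint_eta {k : L → ℕ} (z : ∀ a : V ⊕ L, State c k a) :
    joint (fun v => z (.inl v)) (fun l => z (.inr l)) = z := by
  funext a
  cases a <;> rfl

namespace Parameters

/-- The values `z` of the nodes satisfy the structural equations with error values `e`. -/
def IsSolution (M : G.Parameters c) (e : ∀ a, Fin (M.errorCard a))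
    (z : ∀ a, State c M.latentCard a) : Prop :=
  ∀ a, z a = M.f a (fun p => z p.1) (e a)

theorem existsUnique_isSolution [Finite V] [Finite L] (M : G.Parameters c)
    (e : ∀ a, Fin (M.errorCard a)) : ∃! z, M.IsSolution e z :=
  G.existsUnique_solution fun a pa => M.f a pa (e a)

variable [Fintype V] [Fintype L]

open Classical in
theorem prob_eq (M : G.Parameters c) (x : ∀ i, Fin (c i)) :
    M.prob x = ∑ y : (∀ l, Fin (M.latentCard l)), ∑ e : (∀ a, Fin (M.errorCard a)),
      if M.IsSolution e (joint x y) then ∏ a, M.errorDist a (e a) else 0 := by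
  unfold prob
  refine Finset.sum_congr rfl fun y _ => Finset.sum_congr rfl fun e _ => ?_
  rw [Finset.prod_mul_distrib, Finset.prod_ite_zero]
  simp [IsSolution]

/-- The sum has nonnegative terms, so it is positive exactly when one term is. -/
theorem prob_pos_iff (M : G.Parameters c) (x : ∀ i, Fin (c i)) :
    0 < M.prob x ↔ ∃ e z, M.IsSolution e z ∧ (∀ a, 0 < M.errorDist a (e a)) ∧
      ∀ v, z (.inl v) = x v := by
  classical
  have hnn : ∀ e : (∀ a, Fin (M.errorCard a)), 0 ≤ ∏ a, M.errorDist a (e a) := fun e =>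
    Finset.prod_nonneg fun a _ => (M.errorDist_mem a).1 _
  have hnn' : ∀ y e, 0 ≤ if M.IsSolution e (joint x y) then ∏ a, M.errorDist a (e a) else 0 :=
    fun y e => by split_ifs; exacts [hnn e, le_rfl]
  rw [prob_eq]
  constructor
  · intro h
    obtain ⟨y, -, hy⟩ := Finset.exists_ne_zero_of_sum_ne_zero h.ne'
    obtain ⟨e, -, he⟩ := Finset.exists_ne_zero_of_sum_ne_zero hy
    rw [ite_ne_right_iff] at he
    exact ⟨e, _, he.1, fun a => lt_of_le_of_ne ((M.errorDist_mem a).1 _)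
      (Ne.symm (Finset.prod_ne_zero_iff.1 he.2 a (Finset.mem_univ a))), fun v => rfl⟩
  · rintro ⟨e, z, hz, he, hx⟩
    obtain rfl : (fun v => z (.inl v)) = x := funext hx
    refine Finset.sum_pos' (fun y _ => Finset.sum_nonneg fun e _ => hnn' y e)
      ⟨fun l => z (.inr l), Finset.mem_univ _, ?_⟩
    refine Finset.sum_pos' (fun e _ => hnn' _ e) ⟨e, Finset.mem_univ _, ?_⟩
    rw [joint_eta, if_pos hz]
    exact Finset.prod_pos fun a _ => he a

open Classical in
-- Every error assignment has exactly one solution, so the total weight is the product of the total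
-- weights of the error variables.
theorem prob_mem_stdSimplex (M : G.Parameters c) :
    M.prob ∈ stdSimplex ℝ (∀ i, Fin (c i)) := by
  have hnn : ∀ e : (∀ a, Fin (M.errorCard a)), 0 ≤ ∏ a, M.errorDist a (e a) := fun e =>
    Finset.prod_nonneg fun a _ => (M.errorDist_mem a).1 _
  constructor
  · intro x
    rw [prob_eq]
    refine Finset.sum_nonneg fun y _ => Finset.sum_nonneg fun e _ => ?_
    split_ifs
    exacts [hnn e, le_rfl]
  · simp only [prob_eq]
    rw [← Fintype.sum_prod_type', Finset.sum_comm]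
    have : ∀ e : (∀ a, Fin (M.errorCard a)),
        (∑ p : (∀ i, Fin (c i)) × (∀ l, Fin (M.latentCard l)),
          if M.IsSolution e (joint p.1 p.2) then ∏ a, M.errorDist a (e a) else 0) =
        ∏ a, M.errorDist a (e a) := by
      intro e
      obtain ⟨z, hz, huniq⟩ := M.existsUnique_isSolution e
      rw [Finset.sum_eq_single (fun v => z (.inl v), fun l => z (.inr l))]
      · rw [joint_eta, if_pos hz]
      · rintro ⟨x, y⟩ - hne
        refine if_neg fun h => hne ?_
        rw [← huniq _ h]
        rfl
      · exact fun h => absurd (Finset.mem_univ _) h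
    rw [Finset.sum_congr rfl fun e _ => this e, ← Fintype.prod_sum]
    exact Finset.prod_eq_one fun a _ => (M.errorDist_mem a).2

end Parameters

variable [Fintype V] [Fintype L]

/-- A support is realizable by `G` if and only if it is the set of visible values of the solutions
of structural equations over `G` for the error values of positive probability. -/
theorem mem_realizableSupports_iff {S : Set (∀ i, Fin (c i))} :
    S ∈ G.realizableSupports c ↔ ∃ M : G.Parameters c, ∀ x, x ∈ S ↔
      ∃ e z, M.IsSolution e z ∧ (∀ a, 0 < M.errorDist a (e a)) ∧ ∀ v, z (.inl v) = x v := by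
  constructor
  · rintro ⟨P, ⟨-, M, hM⟩, rfl⟩
    exact ⟨M, fun x => by rw [Set.mem_ofPred_eq, hM, M.prob_pos_iff]⟩
  · rintro ⟨M, hM⟩
    exact ⟨M.prob, ⟨M.prob_mem_stdSimplex, M, fun x => rfl⟩,
      Set.ext fun x => (M.prob_pos_iff x).trans (hM x).symm⟩

/-- Binary structural equations over `G`, given by functions of all the nodes that depend only on
the parents, realize the set of visible values of their solutions. -/
theorem mem_realizableSupports_of_binary (g : V ⊕ L → (V ⊕ L → Fin 2) → Fin 2 → Fin 2)
    (hg : ∀ a z z' e, (∀ p, G.edge p a → z p = z' p) → g a z e = g a z' e) :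
    {x : V → Fin 2 | ∃ e z : V ⊕ L → Fin 2, (∀ a, z a = g a z (e a)) ∧ ∀ v, z (.inl v) = x v} ∈
      G.realizableSupports fun _ => 2 := by
  classical
  let toBit : ∀ a, Fin 2 → State (V := V) (L := L) (fun _ => 2) (fun _ => 2) a :=
    fun a => match a with
    | .inl _ => id
    | .inr _ => id
  let ofBit : ∀ a, State (V := V) (L := L) (fun _ => 2) (fun _ => 2) a → Fin 2 :=
    fun a => match a with
    | .inl _ => id
    | .inr _ => id
  have h1 : ∀ a i, ofBit a (toBit a i) = i := fun a i => by cases a <;> rfl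
  have h2 : ∀ a i, toBit a (ofBit a i) = i := fun a i => by cases a <;> rfl
  let M : G.Parameters (fun _ => 2) :=
    { latentCard := fun _ => 2
      errorCard := fun _ => 2
      f := fun a pa e =>
        -- The default `0` at non-parents is never read, by `hg`.
        toBit a (g a (fun p => if h : G.edge p a then ofBit p (pa ⟨p, h⟩) else 0) e)
      errorDist := fun _ _ => 1 / 2
      errorDist_mem := fun _ => ⟨fun _ => by norm_num, by norm_num⟩ }
  have hM : ∀ e z, M.IsSolution e z ↔ ∀ a, ofBit a (z a) = g a (fun p => ofBit p (z p)) (e a) := by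
    intro e z
    refine forall_congr' fun a => ?_
    have : g a (fun p => if h : G.edge p a then ofBit p (z p) else 0) (e a) =
        g a (fun p => ofBit p (z p)) (e a) :=
      hg _ _ _ _ fun p hp => dif_pos hp
    rw [← this]
    exact ⟨fun h => by rw [h]; exact h1 _ _, fun h => by rw [← h2 a (z a), h]⟩
  refine mem_realizableSupports_iff.2 ⟨M, fun x => ?_⟩
  constructor
  · rintro ⟨e, z, hz, hx⟩
    refine ⟨e, fun a => toBit a (z a), (hM _ _).2 fun a => ?_, fun a => ?_, hx⟩
    · simp only [h1]
      exact hz a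
    · exact one_half_pos
  · rintro ⟨e, z, hz, -, hx⟩
    exact ⟨e, fun a => ofBit a (z a), (hM _ _).1 hz, hx⟩

end PDAG

/-! ### Recombining events under e-separation -/

namespace MDAG

variable {V : Type u} {G : MDAG V} {S : Set V}

theorem exists_facet_induce [Finite V] {F : Finset V} (hF : F ∈ G.complex.faces) {v : V}
    (hv : v ∈ F) (hvS : v ∈ S) :
    ∃ F' : (G.induce S).Facet, ∀ u ∈ F, ∀ h : u ∈ S, (⟨u, h⟩ : S) ∈ F'.1 := by
  classical
  have hmem : F.subtype (· ∈ S) ∈ (G.induce S).complex.faces := by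
    change (F.subtype (· ∈ S)).map (Function.Embedding.subtype _) ∈ G.complex.faces
    refine (G.complex.isRelLowerSet_faces hF).2 (fun u hu => ?_)
      ⟨v, by simp [hv, hvS]⟩
    simp only [Finset.mem_map, Finset.mem_subtype] at hu
    obtain ⟨u', hu', rfl⟩ := hu
    exact hu'
  obtain ⟨F', hle, hF'⟩ := (Set.toFinite (G.induce S).complex.faces).exists_le_maximal hmem
  exact ⟨⟨F', hF'⟩, fun u hu h => hle (Finset.mem_subtype.2 hu)⟩

/-- Extend `F'` to a facet `F` of `G`. The trace of `F` on `S` is a face containing `F'`, hence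
equals it by maximality. -/
theorem exists_facet_of_induce [Finite V] (F' : (G.induce S).Facet) :
    ∃ F : G.Facet, ∀ u : S, u.1 ∈ F.1 ↔ u ∈ F'.1 := by
  classical
  have hmem : F'.1.map (Function.Embedding.subtype _) ∈ G.complex.faces := F'.2.1
  obtain ⟨F, hle, hF⟩ := (Set.toFinite G.complex.faces).exists_le_maximal hmem
  have hsub : ∀ u : S, u ∈ F'.1 → u.1 ∈ F := fun u hu =>
    hle (Finset.mem_map_of_mem (Function.Embedding.subtype _) hu)
  refine ⟨⟨F, hF⟩, fun u => ⟨fun hu => ?_, hsub u⟩⟩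
  obtain ⟨F'', h⟩ := exists_facet_induce (S := S) hF.1 hu u.2
  exact F'.2.2 F''.2.1 (fun w hw => h w.1 (hsub w hw) w.2) (h u.1 hu u.2)

theorem not_canEdge_inr {a : V ⊕ G.Facet} {F : G.Facet} : ¬ G.can.edge a (.inr F) := by
  rintro h
  rcases a with a | a <;> exact h

/-- If `A` and `B` are e-separated by `C` after deletion of `D`, and the nodes in `D` have constant
values on a realizable support, then two of its events that agree on `C` can be combined into an
event that agrees with the first one on `A` and with the second one on `B`. -/
theorem ESep.exists_mem_support [Fintype V] {A B C D : Set V} (h : G.ESep A B C D)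
    (hAD : Disjoint A D) (hBD : Disjoint B D) (hCD : Disjoint C D) {c : V → ℕ}
    {T : Set (∀ i, Fin (c i))} (hT : T ∈ G.realizableSupports c)
    (hD : ∀ x ∈ T, ∀ x' ∈ T, ∀ d ∈ D, x d = x' d) {x x' : ∀ i, Fin (c i)} (hx : x ∈ T)
    (hx' : x' ∈ T) (hC : ∀ v ∈ C, x v = x' v) :
    ∃ x'' ∈ T, (∀ v ∈ A, x'' v = x v) ∧ (∀ v ∈ B, x'' v = x' v) ∧ ∀ v ∈ C, x'' v = x v := by
  classical
  obtain ⟨M, hM⟩ := PDAG.mem_realizableSupports_iff.1 hT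
  obtain ⟨e, z, hz, he, hzx⟩ := (hM x).1 hx
  obtain ⟨e', z', hz', he', hzx'⟩ := (hM x').1 hx'
  obtain ⟨W, hBW, hAW, hW⟩ := DAG.DSep.exists_partition h
  set H := (G.induce Dᶜ).can with hH
  have hWv : ∀ q, (∃ t ∈ A ∪ B ∪ C, ∃ ht : t ∈ Dᶜ, Relation.ReflTransGen H.edge q
      (.inl ⟨t, ht⟩)) → ∀ p p', (p = q ∨ H.edge p q) → (p' = q ∨ H.edge p' q) →
      (∀ v : (Dᶜ : Set V), p = .inl v → v.1 ∉ C) → (∀ v : (Dᶜ : Set V), p' = .inl v → v.1 ∉ C) →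
      p ∈ W → p' ∈ W := by
    rintro q ⟨t, ht, htD, hqt⟩ p p' hp hp' hpC hpC'
    refine hW q ⟨_, ?_, hqt⟩ p p' hp hp' ?_ ?_
    · rcases ht with (ht | ht) | ht
      · exact .inl (.inl ⟨_, ht, rfl⟩)
      · exact .inl (.inr ⟨_, ht, rfl⟩)
      · exact .inr ⟨_, ht, rfl⟩
    · rintro ⟨v, hv, rfl⟩
      exact hpC v rfl hv
    · rintro ⟨v, hv, rfl⟩
      exact hpC' v rfl hv
  let inW : V → Prop := fun v => ∃ hv : v ∈ Dᶜ, Sum.inl ⟨v, hv⟩ ∈ W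
  -- The trace of a facet on `Dᶜ` need not be a facet of the induced complex, so its side is read
  -- off from the induced facets that contain it.
  let facetW : G.Facet → Prop := fun F => ∃ F' : (G.induce Dᶜ).Facet,
    (∀ u ∈ F.1, ∀ hu : u ∈ Dᶜ, (⟨u, hu⟩ : (Dᶜ : Set V)) ∈ F'.1) ∧ Sum.inr F' ∈ W
  -- The error of `v` is chosen by the family of `v` and not by `v` alone: a node of `C` has no
  -- meaningful side, but its error must match its parents.
  let familyW : V → Prop := fun v => ∃ hv : v ∈ Dᶜ, ∃ q, (q = .inl ⟨v, hv⟩ ∨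
    H.edge q (.inl ⟨v, hv⟩)) ∧ (∀ u : (Dᶜ : Set V), q = .inl u → u.1 ∉ C) ∧ q ∈ W
  let side : V ⊕ G.Facet → Prop := Sum.elim familyW facetW
  obtain ⟨ε, hε', hε⟩ : ∃ ε : ∀ a, Fin (M.errorCard a), (∀ a, side a → ε a = e' a) ∧
      ∀ a, ¬ side a → ε a = e a :=
    ⟨fun a => if side a then e' a else e a, fun a ha => if_pos ha, fun a ha => if_neg ha⟩
  obtain ⟨y, hy, -⟩ := M.existsUnique_isSolution ε
  have hyT : (fun v => y (.inl v)) ∈ T := (hM _).2 ⟨_, y, hy, fun a => by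
    by_cases ha : side a
    exacts [hε' a ha ▸ he' a, hε a ha ▸ he a], fun v => rfl⟩
  -- The mixed solution is itself an event of `T`, so the nodes of `D` cannot carry a discrepancy to
  -- their children.
  have hyD : ∀ d ∈ D, y (.inl d) = z (.inl d) ∧ y (.inl d) = z' (.inl d) := fun d hd => by
    rw [hzx, hzx']
    exact ⟨hD _ hyT _ hx d hd, hD _ hyT _ hx' d hd⟩
  have hCz : ∀ v ∈ C, z (.inl v) = z' (.inl v) := fun v hv => by rw [hzx, hzx', hC v hv]
  have hyF : ∀ F : G.Facet, (facetW F → y (.inr F) = z' (.inr F)) ∧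
      (¬ facetW F → y (.inr F) = z (.inr F)) := by
    intro F
    have hpa : ∀ w w' : ∀ a, PDAG.State c M.latentCard a,
        (fun p : {p // G.can.edge p (.inr F)} => w p.1) =
          fun p : {p // G.can.edge p (.inr F)} => w' p.1 :=
      fun w w' => funext fun p => absurd p.2 not_canEdge_inr
    constructor
    · intro hF
      rw [hy (.inr F), hz' (.inr F), hε' _ (show side (.inr F) from hF), hpa y z']
    · intro hF
      rw [hy (.inr F), hz (.inr F), hε _ (show ¬ side (.inr F) from hF), hpa y z]
  have key : ∀ v, ∀ hv : v ∈ Dᶜ, (∃ t ∈ A ∪ B ∪ C, ∃ ht : t ∈ Dᶜ,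
      Relation.ReflTransGen H.edge (.inl ⟨v, hv⟩) (.inl ⟨t, ht⟩)) →
      (inW v → y (.inl v) = z' (.inl v)) ∧ (¬ inW v → y (.inl v) = z (.inl v)) := by
    intro v
    induction v using G.directed.wellFounded_edge.induction with
    | _ v ih =>
    intro hv hanc
    have hanc' : ∀ u, ∀ hu : u ∈ Dᶜ, G.directed.edge u v → ∃ t ∈ A ∪ B ∪ C, ∃ ht : t ∈ Dᶜ,
        Relation.ReflTransGen H.edge (.inl ⟨u, hu⟩) (.inl ⟨t, ht⟩) := by
      obtain ⟨t, ht, htD, hvt⟩ := hanc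
      exact fun u hu huv => ⟨t, ht, htD, .head (show H.edge (.inl ⟨u, hu⟩) (.inl ⟨v, hv⟩)
        from huv) hvt⟩
    have hfam : (familyW v → y (.inl v) = z' (.inl v)) ∧
        (¬ familyW v → y (.inl v) = z (.inl v)) := by
      constructor
      · intro hfv
        have hfv' := hfv
        obtain ⟨_, q, hq, hqC, hqW⟩ := hfv
        rw [hy (.inl v), hz' (.inl v), hε' _ (show side (.inl v) from hfv')]
        congr 1
        funext ⟨p, hp⟩
        rcases p with u | F
        · by_cases hu : u ∈ D
          · exact (hyD u hu).2
          · have ihu := ih u hp hu (hanc' u hu hp)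
            by_cases huC : u ∈ C
            · by_cases huW : inW u
              · exact ihu.1 huW
              · exact (ihu.2 huW).trans (hCz u huC)
            · refine ihu.1 ⟨hu, hWv _ hanc q _ hq (.inr hp) hqC ?_ hqW⟩
              rintro _ ⟨⟩
              exact huC
        · obtain ⟨F', hF'⟩ := exists_facet_induce F.2.1 hp hv
          refine (hyF F).1 ⟨F', hF', hWv _ hanc q _ hq (.inr ?_) hqC (fun _ h => nomatch h) hqW⟩
          exact hF' v hp hv
      · intro hfv
        rw [hy (.inl v), hz (.inl v), hε _ (show ¬ side (.inl v) from hfv)]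
        congr 1
        funext ⟨p, hp⟩
        rcases p with u | F
        · by_cases hu : u ∈ D
          · exact (hyD u hu).1
          · have ihu := ih u hp hu (hanc' u hu hp)
            by_cases huC : u ∈ C
            · by_cases huW : inW u
              · exact (ihu.1 huW).trans (hCz u huC).symm
              · exact ihu.2 huW
            · refine ihu.2 fun ⟨_, huW⟩ => hfv ⟨hv, .inl ⟨u, hu⟩, .inr hp, ?_, huW⟩
              rintro _ ⟨⟩
              exact huC
        · refine (hyF F).2 fun ⟨F', hF', hFW⟩ => hfv ⟨hv, .inr F', .inr ?_, ?_, hFW⟩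
          · exact hF' v hp hv
          · exact fun _ h => nomatch h
    -- On `C` the two events agree, so the side is irrelevant. Outside `C`, `v` belongs to its own
    -- family and lies on the same side.
    by_cases hvC : v ∈ C
    · have := hCz v hvC
      by_cases hfv : familyW v
      · exact ⟨fun _ => hfam.1 hfv, fun _ => (hfam.1 hfv).trans this.symm⟩
      · exact ⟨fun _ => (hfam.2 hfv).trans this, fun _ => hfam.2 hfv⟩
    · have hvC' : ∀ u : (Dᶜ : Set V), (Sum.inl ⟨v, hv⟩ : (Dᶜ : Set V) ⊕ _) =
          (.inl u : _ ⊕ (G.induce Dᶜ).Facet) → u.1 ∉ C := by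
        rintro _ ⟨⟩
        exact hvC
      refine ⟨fun ⟨_, hvW⟩ => hfam.1 ⟨hv, _, .inl rfl, hvC', hvW⟩, fun hvW => hfam.2 ?_⟩
      rintro ⟨_, q, hq, hqC, hqW⟩
      exact hvW ⟨hv, hWv _ hanc q _ hq (.inl rfl) hqC hvC' hqW⟩
  have hmem : ∀ v, v ∈ A ∪ B ∪ C → ∀ hv : v ∈ Dᶜ, (inW v → y (.inl v) = z' (.inl v)) ∧
      (¬ inW v → y (.inl v) = z (.inl v)) :=
    fun v h hv => key v hv ⟨v, h, hv, .refl⟩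
  refine ⟨_, hyT, fun v hv => ?_, fun v hv => ?_, fun v hv => ?_⟩
  · rw [← hzx]
    refine (hmem v (.inl (.inl hv)) (Set.disjoint_left.1 hAD hv)).2 fun ⟨hv', hvW⟩ => ?_
    exact Set.disjoint_left.1 hAW ⟨⟨v, hv'⟩, hv, rfl⟩ hvW
  · rw [← hzx']
    have hv' := Set.disjoint_left.1 hBD hv
    exact (hmem v (.inl (.inr hv)) hv').1 ⟨hv', hBW ⟨⟨v, hv'⟩, hv, rfl⟩⟩
  · rw [← hzx]
    have h1 := hmem v (.inr hv) (Set.disjoint_left.1 hCD hv)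
    by_cases hvW : inW v
    · exact (h1.1 hvW).trans (hCz v hv).symm
    · exact h1.2 hvW

end MDAG

/-! ### Binary equations along an active path -/

theorem SimpleGraph.Walk.infix_support {N : Type u} {K : SimpleGraph N} {a b : N}
    (p : K.Walk a b) {i : ℕ} (hi : i + 2 ≤ p.length) :
    [p.getVert i, p.getVert (i + 1), p.getVert (i + 2)] <:+: p.support := by
  have hlen := p.length_support
  refine ⟨p.support.take i, p.support.drop (i + 3), ?_⟩
  conv_rhs => rw [← List.take_append_drop i p.support,
    List.drop_eq_getElem_cons (i := i) (by omega),
    List.drop_eq_getElem_cons (i := i + 1) (by omega),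
    List.drop_eq_getElem_cons (i := i + 2) (by omega)]
  simp [SimpleGraph.Walk.support_getElem_eq_getVert]

namespace DAG

variable {N : Type u} {G : DAG N} {C : Set N}

/-- Binary structural equations over a DAG that make the ends of an active path equal whenever the
nodes of `C` have the value `0`. Nodes of the path copy their parent on the path, colliders compare
their two parents on the path, and the other nodes report the differences found. -/
theorem exists_binary_equations {a b : N} (ha : a ∉ C) (hb : b ∉ C) (p : G.skeleton.Walk a b)
    (hp : p.IsPath) (hact : G.IsActive C p.support)
    (hdesc : ∀ x m y, [x, m, y] <:+: p.support → G.edge x m → G.edge y m →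
      ∃ c ∈ C, Relation.ReflTransGen (fun u w => G.edge u w ∧ w ∉ p.support) m c) :
    ∃ g : N → (N → Fin 2) → Fin 2 → Fin 2,
      (∀ n z z' e, (∀ q, G.edge q n → z q = z' q) → g n z e = g n z' e) ∧
      (∀ e z : N → Fin 2, (∀ n, z n = g n z (e n)) → (∀ c ∈ C, z c = 0) → z a = z b) ∧
      ∀ β : Fin 2, ∃ e z : N → Fin 2, (∀ n, z n = g n z (e n)) ∧ (∀ c ∈ C, z c = 0) ∧
        z a = β ∧ z b = β := by
  classical
  set w : ℕ → N := p.getVert with hw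
  have hinj : ∀ i ≤ p.length, ∀ j ≤ p.length, w i = w j → i = j :=
    fun i hi j hj h => hp.getVert_injOn hi hj h
  let inL : ℕ → Prop := fun i => 0 < i ∧ G.edge (w (i - 1)) (w i)
  let inR : ℕ → Prop := fun i => i < p.length ∧ G.edge (w (i + 1)) (w i)
  -- Holds at the colliders of the path and, vacuously, at every node off the path: these are the
  -- nodes that carry reports of a difference.
  let flag : N → Prop := fun n => ∀ i ≤ p.length, w i = n → inL i ∧ inR i
  have hLR : ∀ i, inL i → ¬ inR (i - 1) := fun i hi hi' => by
    have h := hi'.2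
    rw [Nat.sub_add_cancel hi.1] at h
    exact G.not_edge_symm hi.2 h
  have hRL : ∀ i, inR i → ¬ inL (i + 1) := fun i hi hi' => G.not_edge_symm hi.2 hi'.2
  have hadj : ∀ i < p.length, ¬ inR i → inL (i + 1) := fun i hi h =>
    ⟨i.succ_pos, (p.adj_getVert_succ hi).resolve_right fun h' => h ⟨hi, h'⟩⟩
  have htriple : ∀ i, 0 < i → i < p.length →
      [w (i - 1), w i, w (i + 1)] <:+: p.support := by
    intro i h0 hi
    obtain ⟨j, rfl⟩ : ∃ j, i = j + 1 := ⟨i - 1, by omega⟩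
    exact p.infix_support (by omega)
  have hsupp : ∀ n, n ∈ p.support ↔ ∃ i ≤ p.length, w i = n := fun n => by
    rw [SimpleGraph.Walk.mem_support_iff_exists_getVert]
    exact exists_congr fun i => and_comm
  let path : ℕ → (N → Fin 2) → Fin 2 → Fin 2 := fun i z e =>
    if inL i ∧ inR i then (if z (w (i - 1)) = z (w (i + 1)) then 0 else 1)
    else if inL i then z (w (i - 1)) else if inR i then z (w (i + 1)) else e
  let g : N → (N → Fin 2) → Fin 2 → Fin 2 := fun n z e =>
    if h : ∃ i ≤ p.length, w i = n then path h.choose z e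
    else if ∃ q, G.edge q n ∧ flag q ∧ z q = 1 then 1 else 0
  have g_on : ∀ i ≤ p.length, ∀ z e, g (w i) z e = path i z e := by
    intro i hi z e
    have h : ∃ j ≤ p.length, w j = w i := ⟨i, hi, rfl⟩
    have hc : h.choose = i := hinj _ h.choose_spec.1 _ hi h.choose_spec.2
    simp only [g, dif_pos h, hc]
  have g_off : ∀ n, n ∉ p.support → ∀ z e,
      g n z e = if ∃ q, G.edge q n ∧ flag q ∧ z q = 1 then 1 else 0 :=
    fun n hn z e => dif_neg fun h => hn ((hsupp n).2 h)
  refine ⟨g, ?_, ?_, ?_⟩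
  · intro n z z' e h
    by_cases hn : n ∈ p.support
    · obtain ⟨i, hi, rfl⟩ := (hsupp n).1 hn
      rw [g_on i hi, g_on i hi]
      dsimp only [path]
      split_ifs with h1 h2 h3 h4 h5 h6
      any_goals rfl
      · exact absurd ((h _ h1.1.2).symm.trans (h2.trans (h _ h1.2.2))) h3
      · exact absurd ((h _ h1.1.2).trans (h4.trans (h _ h1.2.2).symm)) h2
      · exact h _ h5.2
      · exact h _ h6.2
    · rw [g_off n hn, g_off n hn]
      refine if_congr (exists_congr fun q => ?_) rfl rfl
      exact and_congr_right fun hq => by rw [h q hq]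
  · intro e z hz hC
    have hon : ∀ i ≤ p.length, z (w i) = path i z (e (w i)) := fun i hi => by
      rw [← g_on i hi]
      exact hz _
    -- A collider with value `1` would send this `1` down its descent, all of whose nodes are off
    -- the path, to a node of `C`.
    have hcol : ∀ i ≤ p.length, inL i → inR i → z (w i) = 0 := by
      intro i hi hL hR
      obtain ⟨c, hc, hr⟩ := hdesc _ _ _ (htriple i hL.1 hR.1) hL.2 hR.2
      by_contra hne
      have h1 : z (w i) = 1 := Fin.eq_one_of_ne_zero _ hne
      have : flag c ∧ z c = 1 := by
        clear hc
        induction hr with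
        | refl =>
          refine ⟨fun j hj hij => ?_, h1⟩
          obtain rfl := hinj _ hj _ hi hij
          exact ⟨hL, hR⟩
        | tail _ huv ih =>
          refine ⟨fun j hj hij => absurd ((hsupp _).2 ⟨j, hj, hij⟩) huv.2, ?_⟩
          rw [hz, g_off _ huv.2, if_pos ⟨_, huv.1, ih⟩]
      rw [hC c hc] at this
      exact absurd this.2 (by decide)
    -- Strong induction is needed to jump over a collider, from `i - 1` to `i + 1`; two colliders
    -- are never adjacent.
    have key : ∀ i ≤ p.length, ¬ (inL i ∧ inR i) → z (w i) = z (w 0) := by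
      intro i
      induction i using Nat.strong_induction_on with
      | _ i ih =>
      intro hi hn
      rcases i with _ | i
      · rfl
      by_cases hR : inR i
      · by_cases hL : inL i
        · have h0 := hcol i (by omega) hL hR
          rw [hon i (by omega)] at h0
          simp only [path, if_pos (And.intro hL hR)] at h0
          have h1 : z (w (i - 1)) = z (w (i + 1)) := by
            by_contra hne
            rw [if_neg hne] at h0
            exact absurd h0 (by decide)
          rw [← h1]
          exact ih (i - 1) (by omega) (by omega) fun h => hLR i hL h.2
        · have h0 := hon i (by omega)
          simp only [path, if_neg (fun h : inL i ∧ inR i => hL h.1), if_neg hL, if_pos hR] at h0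
          rw [← h0]
          exact ih i (by omega) (by omega) fun h => hL h.1
      · have hL := hadj i (by omega) hR
        have h0 := hon (i + 1) hi
        simp only [path, if_neg hn, if_pos hL] at h0
        rw [h0]
        exact ih i (by omega) (by omega) fun h => hR h.2
    have := key p.length le_rfl fun h => absurd h.2.1 (lt_irrefl _)
    rw [hw, SimpleGraph.Walk.getVert_length, SimpleGraph.Walk.getVert_zero] at this
    exact this.symm
  · intro β
    let z : N → Fin 2 := fun n => if flag n then 0 else β
    have hflag : ∀ i ≤ p.length, flag (w i) ↔ inL i ∧ inR i := by
      refine fun i hi => ⟨fun h => h i hi rfl, fun h j hj hij => ?_⟩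
      obtain rfl := hinj _ hj _ hi hij
      exact h
    have hz : ∀ i ≤ p.length, ¬ (inL i ∧ inR i) → z (w i) = β := fun i hi h =>
      if_neg fun h' => h ((hflag i hi).1 h')
    have hzL : ∀ i ≤ p.length, inL i → z (w (i - 1)) = β := fun i hi h =>
      hz (i - 1) (by omega) fun h' => hLR i h h'.2
    have hzR : ∀ i ≤ p.length, inR i → z (w (i + 1)) = β := fun i hi h =>
      hz (i + 1) h.1 fun h' => hRL i h h'.1
    refine ⟨fun _ => β, z, fun n => ?_, fun c hc => ?_, ?_, ?_⟩
    · by_cases hn : n ∈ p.support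
      · obtain ⟨i, hi, rfl⟩ := (hsupp n).1 hn
        rw [g_on i hi]
        dsimp only [path]
        split_ifs with h1 h2 h3 h4
        · exact if_pos ((hflag i hi).2 h1)
        · exact absurd ((hzL i hi h1.1).trans (hzR i hi h1.2).symm) h2
        · rw [hzL i hi h3, hz i hi h1]
        · rw [hzR i hi h4, hz i hi h1]
        · exact hz i hi h1
      · rw [g_off n hn, if_neg]
        · exact if_pos fun i hi h => absurd ((hsupp n).2 ⟨i, hi, h⟩) hn
        · rintro ⟨q, -, hq, hq'⟩
          rw [show z q = 0 from if_pos hq] at hq'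
          exact absurd hq' (by decide)
    · refine if_pos fun i hi h => ?_
      subst h
      have h0 : 0 < i := by
        rcases i with _ | i
        · rw [hw, SimpleGraph.Walk.getVert_zero] at hc
          exact absurd hc ha
        · exact i.succ_pos
      have hlt : i < p.length := by
        refine lt_of_le_of_ne hi ?_
        rintro rfl
        rw [hw, SimpleGraph.Walk.getVert_length] at hc
        exact hb hc
      by_contra hn
      exact (hact _ _ _ (htriple i h0 hlt)).2 (fun h => hn ⟨⟨h0, h.1⟩, hlt, h.2⟩) hc
    · have := hz 0 (Nat.zero_le _) fun h => absurd h.1.1 (lt_irrefl _)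
      rwa [hw, SimpleGraph.Walk.getVert_zero] at this
    · have := hz p.length le_rfl fun h => absurd h.2.1 (lt_irrefl _)
      rwa [hw, SimpleGraph.Walk.getVert_length] at this

end DAG

/-! ### The separating support and the conclusion -/

namespace MDAG

variable {V : Type u} {G : MDAG V}

/-- If `A` and `B` are not e-separated by `C` after deletion of `D`, some realizable binary support
has no event that distinguishes a certain node of `A` from a certain node of `B` while the nodes of
`C` have the value `0`, although both values of the two nodes are possible. -/
theorem exists_support_of_not_eSep [Fintype V] {A B C D : Set V} (h : ¬ G.ESep A B C D)
    (hAC : Disjoint A C) (hBC : Disjoint B C) (hCD : Disjoint C D) :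
    ∃ a ∈ A, ∃ b ∈ B, ∃ T ∈ G.realizableSupports fun _ => 2,
      (∀ x ∈ T, ∀ d ∈ D, x d = 0) ∧ (∀ x ∈ T, (∀ c ∈ C, x c = 0) → x a = x b) ∧
      ∀ β : Fin 2, ∃ x ∈ T, (∀ c ∈ C, x c = 0) ∧ x a = β ∧ x b = β := by
  classical
  have hdisj : ∀ {X : Set V}, Disjoint X C →
      Disjoint (Sum.inl '' (Subtype.val ⁻¹' X) : Set ((Dᶜ : Set V) ⊕ (G.induce Dᶜ).Facet))
        (Sum.inl '' (Subtype.val ⁻¹' C)) := fun hX =>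
    (Set.disjoint_image_iff Sum.inl_injective).2 (hX.preimage _)
  obtain ⟨a', ⟨a, ha, rfl⟩, b', ⟨b, hb, rfl⟩, p, hp, hact, hdesc⟩ :=
    DAG.exists_route_of_not_dsep h (hdisj hAC) (hdisj hBC)
  obtain ⟨g, hg, hg1, hg2⟩ := DAG.exists_binary_equations
    (Set.disjoint_left.1 (hdisj hAC) ⟨a, ha, rfl⟩) (Set.disjoint_left.1 (hdisj hBC) ⟨b, hb, rfl⟩)
    p hp hact hdesc
  choose φ hφ using exists_facet_of_induce (G := G) (S := Dᶜ)
  -- Embeds the canonical pDAG of the induced mDAG into that of `G`. Nodes outside the image, in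
  -- particular those of `D`, will be constantly `0`.
  let ι : (Dᶜ : Set V) ⊕ (G.induce Dᶜ).Facet → V ⊕ G.Facet := Sum.map Subtype.val φ
  have hι : Function.Injective ι := by
    refine Subtype.val_injective.sumMap fun F F' h => Subtype.ext (Finset.ext fun u => ?_)
    rw [← hφ, ← hφ, h]
  have hedge : ∀ n m, (G.induce Dᶜ).can.edge n m → G.can.edge (ι n) (ι m) := by
    rintro (n | F) (m | F') h
    · exact h
    · exact h.elim
    · exact (hφ F m).2 h
    · exact h.elim
  let k : V ⊕ G.Facet → (V ⊕ G.Facet → Fin 2) → Fin 2 → Fin 2 := fun n z e =>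
    if h : ∃ m, ι m = n then g h.choose (z ∘ ι) e else 0
  have k_on : ∀ m z e, k (ι m) z e = g m (z ∘ ι) e := by
    intro m z e
    have h : ∃ m', ι m' = ι m := ⟨m, rfl⟩
    have hc : h.choose = m := hι h.choose_spec
    simp only [k, dif_pos h, hc]
  have k_off : ∀ n, (¬ ∃ m, ι m = n) → ∀ z e, k n z e = 0 := fun n hn z e => dif_neg hn
  have hT := PDAG.mem_realizableSupports_of_binary (G := G.can) k fun n z z' e hz => by
    by_cases hn : ∃ m, ι m = n
    · obtain ⟨m, rfl⟩ := hn
      rw [k_on, k_on]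
      exact hg _ _ _ _ fun q hq => hz _ (hedge _ _ hq)
    · rw [k_off n hn, k_off n hn]
  refine ⟨a, ha, b, hb, _, hT, ?_, ?_, ?_⟩
  · rintro x ⟨e, z, hz, hx⟩ d hd
    rw [← hx, hz, k_off]
    rintro ⟨m | F, hm⟩
    · cases hm
      exact m.2 hd
    · cases hm
  · rintro x ⟨e, z, hz, hx⟩ hC
    have := hg1 (e ∘ ι) (z ∘ ι) (fun m => by rw [← k_on]; exact hz _) (by
      rintro _ ⟨c, hc, rfl⟩
      exact (hx c).trans (hC c hc))
    rw [← hx, ← hx]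
    exact this
  · intro β
    obtain ⟨e, z, hz, hC, hza, hzb⟩ := hg2 β
    have hext : Function.extend ι z 0 ∘ ι = z := Function.extend_comp hι z 0
    refine ⟨fun v => Function.extend ι z 0 (.inl v), ⟨Function.extend ι e 0,
      Function.extend ι z 0, fun n => ?_, fun v => rfl⟩, fun c hc => ?_, ?_, ?_⟩
    · by_cases hn : ∃ m, ι m = n
      · obtain ⟨m, rfl⟩ := hn
        rw [k_on, hext, hι.extend_apply, hι.extend_apply]
        exact hz m
      · rw [k_off n hn, Function.extend_apply' _ _ _ hn]
        rfl
    · have := hC (.inl ⟨c, Set.disjoint_left.1 hCD hc⟩) ⟨_, hc, rfl⟩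
      rw [← this]
      exact hι.extend_apply z 0 (.inl ⟨c, Set.disjoint_left.1 hCD hc⟩)
    · exact (hι.extend_apply z 0 (.inl a)).trans hza
    · exact (hι.extend_apply z 0 (.inl b)).trans hzb

theorem exists_support_of_not_subset [Fintype V] {G G' : MDAG V}
    (h : ¬ G.eSepRelations ⊆ G'.eSepRelations) :
    ∃ S : Set (V → Fin 2),
      S ∈ G'.realizableSupports (fun _ => 2) ∧ S ∉ G.realizableSupports (fun _ => 2) := by
  obtain ⟨⟨A, B, C, D⟩, ⟨hdisj, hsep⟩, hn⟩ := Set.not_subset.1 h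
  have hsep' : ¬ G'.ESep A B C D := fun h' => hn ⟨hdisj, h'⟩
  simp only [List.pairwise_cons, List.mem_cons, List.not_mem_nil, or_false, forall_eq_or_imp,
    forall_eq] at hdisj
  obtain ⟨⟨-, hAC, hAD⟩, ⟨hBC, hBD⟩, hCD, -⟩ := hdisj
  obtain ⟨a, ha, b, hb, T, hT, hTD, hTC, hTβ⟩ := exists_support_of_not_eSep hsep' hAC hBC hCD
  refine ⟨T, hT, fun hT' => ?_⟩
  obtain ⟨x, hx, hxC, hxa, -⟩ := hTβ 0
  obtain ⟨x', hx', hxC', -, hxb'⟩ := hTβ 1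
  -- The recombined event has `y a = 0`, `y b = 1` and still `C = 0`.
  obtain ⟨y, hy, hyA, hyB, hyC⟩ := hsep.exists_mem_support hAD hBD hCD hT'
    (fun x hx x' hx' d hd => by rw [hTD x hx d hd, hTD x' hx' d hd]) hx hx'
    (fun v hv => by rw [hxC v hv, hxC' v hv])
  have := hTC y hy fun c hc => (hyC c hc).trans (hxC c hc)
  rw [hyA a ha, hyB b hb, hxa, hxb'] at this
  exact absurd this (by decide)

end MDAG

theorem mainTheorem7 {V : Type*} [Fintype V] (G G' : MDAG V) :
    (G.eSepRelations ≠ G'.eSepRelations →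
      ∃ S : Set (V → Fin 2),
        (S ∈ G.realizableSupports (fun _ => 2) ∧ S ∉ G'.realizableSupports (fun _ => 2)) ∨
        (S ∈ G'.realizableSupports (fun _ => 2) ∧ S ∉ G.realizableSupports (fun _ => 2))) ∧
    (¬ G.eSepRelations ⊆ G'.eSepRelations →
      ∃ S : Set (V → Fin 2),
        S ∈ G'.realizableSupports (fun _ => 2) ∧ S ∉ G.realizableSupports (fun _ => 2)) := by
  refine ⟨fun h => ?_, MDAG.exists_support_of_not_subset⟩
  by_cases hsub : G.eSepRelations ⊆ G'.eSepRelations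
  · obtain ⟨S, hS⟩ := MDAG.exists_support_of_not_subset fun h' => h (hsub.antisymm h')
    exact ⟨S, .inl hS⟩
  · obtain ⟨S, hS⟩ := MDAG.exists_support_of_not_subset hsub
    exact ⟨S, .inr hS⟩
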